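/- Let $N\ge 1$ be an integer and let $q=\{a_n,b_n\}_{n\in\mathbb Z}$ be Jacobi coefficients with $a_n>0$, $b_n\in\mathbb R$, and $$a_n,\ b_n=o\bigl(|n|^{1/N}\bigr)\qquad\text{as } n\to\pm\infty .$$ Let $(H_qu)_n=a_{n+1}u_{n+1}+a_nu_{n-1}+b_nu_n$, and let $H_q^{+}$ and $H_q^{-}$ be its restrictions to the half-lines $\{n\ge 1\}$ and $\{n\le -1\}$ (with Dirichlet condition at $n=0$). Then $q\in Q_N$, that is: both boundaries $\pm\infty$ are of limit point type, so that the Weyl functions $m_\pm$ are well defined as the limits of the Weyl disks, they are represented as $$m_\pm(z)=\bigl((H_q^{\pm}-z)^{-1}\delta_{\pm1},\delta_{\pm1}\bigr)=\int_{-\infty}^{\infty}\frac{\sigma_\pm(d\lambda)}{\lambda-z}\qquad(\operatorname{Im}z>0)$$ by finite measures $\sigma_\pm$ on $\mathbb R$ (the spectral measures), and $$\int_{-\infty}^{\infty}e^{c|\lambda|^{N}}\,\sigma_\pm(d\lambda)<\infty\qquad\text{for every } c>0 .$$ -/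

import Mathlib

open MeasureTheory Filter Asymptotics

/-- Jacobi coefficients `q = {a_n, b_n}` on `ℤ`, with `a_n > 0` and `b_n` real. They belong to the
Jacobi operator `(H_q u)_n = a_{n+1} u_{n+1} + a_n u_{n-1} + b_n u_n`. -/
structure JacobiCoeff where
  /-- the off-diagonal coefficients; `a n` couples the sites `n - 1` and `n` -/
  a : ℤ → ℝ
  /-- the diagonal coefficients -/
  b : ℤ → ℝ
  a_pos : ∀ n, 0 < a n

namespace JacobiCoeff

/-- The coefficients of the Jacobi operator after the reflection `n ↦ -n` of `ℤ`: the site `n`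
becomes `-n`, and the bond between `n - 1` and `n` becomes the bond between `-n` and `1 - n`. -/
def reflect (q : JacobiCoeff) : JacobiCoeff where
  a n := q.a (1 - n)
  b n := q.b (-n)
  a_pos n := q.a_pos (1 - n)

/-- The solution `f_0, f_1, f_2, …` of
`a_{n+1} f_{n+1} + a_n f_{n-1} + b_n f_n = z f_n` for `n ≥ 1`, with given `f_0` and `f_1`. -/
noncomputable def sol (q : JacobiCoeff) (z f₀ f₁ : ℂ) : ℕ → ℂ
  | 0 => f₀
  | 1 => f₁
  | n + 2 => ((z - (q.b (n + 1) : ℂ)) * sol q z f₀ f₁ (n + 1)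
      - (q.a (n + 1) : ℂ) * sol q z f₀ f₁ n) / (q.a (n + 2) : ℂ)

/-- The fundamental solution with `c_0 = 1`, `c_1 = 0`. -/
noncomputable def cSol (q : JacobiCoeff) (z : ℂ) : ℕ → ℂ := q.sol z 1 0

/-- The fundamental solution with `s_0 = 0`, `s_1 = 1`. -/
noncomputable def sSol (q : JacobiCoeff) (z : ℂ) : ℕ → ℂ := q.sol z 0 1

/-- The Weyl disk of level `L` at `z` in the upper half-plane, for the half-line `n ≥ 1`. The
normalization is the one in which the Weyl function is `⟨(H_q^+ - z)⁻¹ δ_1, δ_1⟩`, where `H_q^+` is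
the restriction of `H_q` to `n ≥ 1`: the solution `f_n = c_n - a_1 m s_n` has
`f_0 = 1` and `m = - f_1 / (a_1 f_0)`. -/
def weylDisk (q : JacobiCoeff) (L : ℕ) (z : ℂ) : Set ℂ :=
  {m | 0 < m.im ∧
    ∑ n ∈ Finset.Icc 1 L, ‖q.cSol z n - (q.a 1 : ℂ) * m * q.sSol z n‖ ^ 2
      ≤ q.a 1 ^ 2 * m.im / z.im}

/-- The limit of the decreasing sequence of Weyl disks at `z`. -/
def weylLimit (q : JacobiCoeff) (z : ℂ) : Set ℂ := ⋂ L : ℕ, q.weylDisk (L + 1) z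

/-- The boundary `+∞` is of limit point type, and `m` is the (right) Weyl function on the
upper half-plane: the Weyl disks at `z` shrink to the single point `m z`. -/
def IsWeylFunction (q : JacobiCoeff) (m : ℂ → ℂ) : Prop :=
  ∀ z : ℂ, 0 < z.im → q.weylLimit z = {m z}

/-- The boundary `+∞` is of limit point type, and `σ` is the spectral measure on `ℝ` of the
half-line operator on `n ≥ 1`, i.e. the finite measure that represents the Weyl function as
`m(z) = ∫ σ(dx) / (x - z)`. By Stieltjes inversion there is at most one such `σ`. -/
def IsSpectralMeasure (q : JacobiCoeff) (σ : Measure ℝ) : Prop :=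
  IsFiniteMeasure σ ∧ q.IsWeylFunction (fun z => ∫ x : ℝ, 1 / ((x : ℂ) - z) ∂σ)

end JacobiCoeff

/-- The space `Q_N`: both boundaries `±∞` are of limit point type, and the spectral measures
`σ_+` (half-line `n ≥ 1`) and `σ_-` (half-line `n ≤ -1`, read through the reflection) satisfy
`∫ exp (c |x| ^ N) σ_±(dx) < ∞` for every `c > 0`. -/
def JacobiQ (N : ℕ) : Set JacobiCoeff :=
  {q | ∃ σp σm : Measure ℝ, q.IsSpectralMeasure σp ∧ q.reflect.IsSpectralMeasure σm ∧
    ∀ c : ℝ, 0 < c →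
      ∫⁻ x, ENNReal.ofReal (Real.exp (c * |x| ^ N)) ∂σp < ⊤ ∧
      ∫⁻ x, ENNReal.ofReal (Real.exp (c * |x| ^ N)) ∂σm < ⊤}

/-! Let `J_L` be the half-line matrix cut to `L + 1` sites and `μ_L` its spectral measure at the
first site. The `p`-th moment of `μ_L` is `(J_L ^ p) 0 0`. It sees only coefficients of index at
most `p + 1`, so slow growth bounds the moments of order `2iN` uniformly in `L`. Summing the cosh
series bounds all exponential moments (`HasSlowGrowth.lintegral_exp_truncMeasure_le`). Hence the
`μ_L` are tight, and any weak limit point inherits the bounds.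

The Stieltjes transform of `μ_L` satisfies every Weyl disk inequality of level at most `L + 1`
(`sum_weylSol_truncWeyl_le`). These are closed conditions, so the limit transform lies in every
disk. By Carleman's condition the disks share only one point (`eq_of_weylSol_bounded`), so the limit
measure is the spectral measure. Reflection handles the other half-line. -/

namespace JacobiCoeff

/-! ### Weyl solutions and their Wronskian -/

/-- The solution `c_n - a_1 m s_n`, normalized by `f_0 = 1`, with Weyl parameter `m`. -/
noncomputable def weylSol (q : JacobiCoeff) (z m : ℂ) (n : ℕ) : ℂ :=
  q.cSol z n - (q.a 1 : ℂ) * m * q.sSol z n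

lemma weylSol_zero (q : JacobiCoeff) (z m : ℂ) : q.weylSol z m 0 = 1 := by
  simp [weylSol, cSol, sSol, sol]

lemma weylSol_one (q : JacobiCoeff) (z m : ℂ) : q.weylSol z m 1 = -(q.a 1 * m) := by
  simp [weylSol, cSol, sSol, sol]

lemma a_ne_zero (q : JacobiCoeff) (n : ℤ) : (q.a n : ℂ) ≠ 0 :=
  Complex.ofReal_ne_zero.2 (q.a_pos n).ne'

lemma weylSol_add_two (q : JacobiCoeff) (z m : ℂ) (n : ℕ) :
    q.weylSol z m (n + 2) = ((z - (q.b (n + 1) : ℂ)) * q.weylSol z m (n + 1)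
      - (q.a (n + 1) : ℂ) * q.weylSol z m n) / (q.a (n + 2) : ℂ) := by
  simp only [weylSol, cSol, sSol, sol]
  ring

lemma mul_weylSol_add_two (q : JacobiCoeff) (z m : ℂ) (n : ℕ) :
    (q.a (n + 2) : ℂ) * q.weylSol z m (n + 2) = (z - (q.b (n + 1) : ℂ)) * q.weylSol z m (n + 1)
      - (q.a (n + 1) : ℂ) * q.weylSol z m n := by
  rw [weylSol_add_two, mul_div_cancel₀ _ (q.a_ne_zero _)]

lemma wronskian_weylSol (q : JacobiCoeff) (z m m' : ℂ) (n : ℕ) :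
    (q.a (n + 1) : ℂ) * (q.weylSol z m n * q.weylSol z m' (n + 1)
      - q.weylSol z m (n + 1) * q.weylSol z m' n) = (q.a 1 : ℂ) ^ 2 * (m - m') := by
  induction n with
  | zero => simp [weylSol_zero, weylSol_one]; ring
  | succ n ih =>
    rw [← ih]
    have h := q.mul_weylSol_add_two z m n
    have h' := q.mul_weylSol_add_two z m' n
    have e : ((n + 1 : ℕ) : ℤ) + 1 = n + 2 := by push_cast; ring
    rw [e]
    linear_combination q.weylSol z m (n + 1) * h' - q.weylSol z m' (n + 1) * h

/-! ### Slow growth and the limit point case -/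

/-- The coefficients grow slower than `|n| ^ (1 / N)`, stated without real powers. -/
def HasSlowGrowth (q : JacobiCoeff) (N : ℕ) : Prop :=
  ∀ ε : ℝ, 0 < ε → ∃ K : ℝ, 0 ≤ K ∧ ∀ n : ℤ,
    q.a n ^ N ≤ ε * (|(n : ℝ)| + K) ∧ |q.b n| ^ N ≤ ε * (|(n : ℝ)| + K)

lemma HasSlowGrowth.reflect {q : JacobiCoeff} {N : ℕ} (h : q.HasSlowGrowth N) :
    q.reflect.HasSlowGrowth N := by
  intro ε hε
  obtain ⟨K, hK, hb⟩ := h ε hε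
  refine ⟨K + 1, by positivity, fun n => ⟨?_, ?_⟩⟩
  · refine (hb (1 - n)).1.trans (mul_le_mul_of_nonneg_left ?_ hε.le)
    have := abs_sub (1 : ℝ) n
    push_cast
    rw [abs_one] at this
    linarith
  · refine (hb (-n)).2.trans (mul_le_mul_of_nonneg_left ?_ hε.le)
    push_cast
    rw [abs_neg]
    linarith

/-- The asymptotic bound fails at only finitely many sites, and `K` absorbs those. -/
lemma exists_abs_pow_le_of_isLittleO {N : ℕ} (hN : 1 ≤ N) {f : ℤ → ℝ}
    (hf : f =o[atBot ⊔ atTop] fun n : ℤ => |(n : ℝ)| ^ (1 / (N : ℝ))) {ε : ℝ} (hε : 0 < ε) :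
    ∃ K : ℝ, 0 ≤ K ∧ ∀ n : ℤ, |f n| ^ N ≤ ε * (|(n : ℝ)| + K) := by
  rw [← Int.cofinite_eq] at hf
  have hN' : N ≠ 0 := by omega
  have h := hf.def (c := ε ^ (1 / (N : ℝ))) (by positivity)
  have h1 : ∀ᶠ n : ℤ in cofinite, |f n| ^ N ≤ ε * |(n : ℝ)| := by
    filter_upwards [h] with n hn
    rw [Real.norm_eq_abs, Real.norm_eq_abs, abs_of_nonneg (Real.rpow_nonneg (abs_nonneg (n : ℝ)) _),
      ← Real.mul_rpow hε.le (abs_nonneg _)] at hn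
    calc |f n| ^ N ≤ ((ε * |(n : ℝ)|) ^ (1 / (N : ℝ))) ^ N := by gcongr
      _ = ε * |(n : ℝ)| := by
        rw [one_div, Real.rpow_inv_natCast_pow (by positivity) hN']
  have hfin : {n : ℤ | ¬ |f n| ^ N ≤ ε * |(n : ℝ)|}.Finite := eventually_cofinite.1 h1
  refine ⟨∑ n ∈ hfin.toFinset, |f n| ^ N / ε,
    Finset.sum_nonneg fun _ _ => by positivity, fun n => ?_⟩
  by_cases hn : |f n| ^ N ≤ ε * |(n : ℝ)|
  · refine hn.trans (mul_le_mul_of_nonneg_left (le_add_of_nonneg_right ?_) hε.le)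
    exact Finset.sum_nonneg fun _ _ => by positivity
  · have : |f n| ^ N / ε ≤ ∑ n ∈ hfin.toFinset, |f n| ^ N / ε :=
      Finset.single_le_sum (f := fun n => |f n| ^ N / ε) (fun _ _ => by positivity) (by simpa using hn)
    rw [div_le_iff₀ hε] at this
    have h0 := mul_nonneg hε.le (abs_nonneg (n : ℝ))
    linarith

lemma hasSlowGrowth_of_isLittleO {q : JacobiCoeff} {N : ℕ} (hN : 1 ≤ N)
    (ha : q.a =o[atBot ⊔ atTop] fun n : ℤ => |(n : ℝ)| ^ (1 / (N : ℝ)))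
    (hb : q.b =o[atBot ⊔ atTop] fun n : ℤ => |(n : ℝ)| ^ (1 / (N : ℝ))) :
    q.HasSlowGrowth N := by
  intro ε hε
  obtain ⟨K, hK, h⟩ := exists_abs_pow_le_of_isLittleO hN ha hε
  obtain ⟨K', hK', h'⟩ := exists_abs_pow_le_of_isLittleO hN hb hε
  refine ⟨K + K', by positivity, fun n => ⟨?_, ?_⟩⟩
  · have := h n
    rw [abs_of_pos (q.a_pos n)] at this
    exact this.trans (mul_le_mul_of_nonneg_left (by linarith) hε.le)
  · exact (h' n).trans (mul_le_mul_of_nonneg_left (by linarith) hε.le)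

/-- Carleman's condition. -/
lemma HasSlowGrowth.not_summable_inv {q : JacobiCoeff} {N : ℕ} (hN : 1 ≤ N)
    (h : q.HasSlowGrowth N) : ¬ Summable fun n : ℕ => (q.a (n + 1))⁻¹ := by
  obtain ⟨K, hK, hb⟩ := h 1 one_pos
  obtain ⟨k, hk⟩ := exists_nat_ge (K + 2)
  intro hs
  have key : ∀ n : ℕ, (((n + k : ℕ) : ℝ))⁻¹ ≤ (q.a (n + 1))⁻¹ := fun n => by
    refine inv_anti₀ (q.a_pos _) ?_
    have h1 := (hb (n + 1)).1
    push_cast at h1 ⊢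
    rw [abs_of_nonneg (by positivity)] at h1
    rcases le_total (q.a (n + 1)) 1 with h2 | h2
    · have : (0 : ℝ) ≤ n := by positivity
      linarith
    · have := le_self_pow₀ h2 (by omega : N ≠ 0)
      linarith
  have := hs.of_nonneg_of_le (fun n => by positivity) key
  rw [summable_nat_add_iff k (f := fun n : ℕ => ((n : ℝ))⁻¹)] at this
  exact Real.not_summable_natCast_inv this

lemma sum_Icc_one_eq_sum_range (f : ℕ → ℝ) (n : ℕ) :
    ∑ i ∈ Finset.Icc 1 n, f i = ∑ i ∈ Finset.range n, f (i + 1) := by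
  induction n with
  | zero => simp
  | succ n ih => rw [Finset.sum_Icc_succ_top (by omega), Finset.sum_range_succ, ih]

/-- The limit point case, from Carleman's condition. -/
lemma eq_of_weylSol_bounded {q : JacobiCoeff} {N : ℕ} (hN : 1 ≤ N) (h : q.HasSlowGrowth N)
    {z m m' : ℂ} {C C' : ℝ}
    (hm : ∀ L : ℕ, ∑ n ∈ Finset.Icc 1 (L + 1), ‖q.weylSol z m n‖ ^ 2 ≤ C)
    (hm' : ∀ L : ℕ, ∑ n ∈ Finset.Icc 1 (L + 1), ‖q.weylSol z m' n‖ ^ 2 ≤ C') : m = m' := by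
  by_contra hne
  have toSum : ∀ {m : ℂ} {C : ℝ},
      (∀ L : ℕ, ∑ n ∈ Finset.Icc 1 (L + 1), ‖q.weylSol z m n‖ ^ 2 ≤ C) →
      Summable fun n => ‖q.weylSol z m n‖ ^ 2 := fun {m C} hm => by
    rw [← summable_nat_add_iff 1]
    refine summable_of_sum_range_le (c := C) (fun _ => by positivity) fun n => ?_
    refine le_trans ?_ (hm n)
    rw [sum_Icc_one_eq_sum_range, Finset.sum_range_succ]
    exact le_add_of_nonneg_right (by positivity)
  have hs := toSum hm
  have hs' := toSum hm'
  have hs1 := (summable_nat_add_iff 1).2 hs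
  have hs1' := (summable_nat_add_iff 1).2 hs'
  have hW : 0 < q.a 1 ^ 2 * ‖m - m'‖ :=
    mul_pos (pow_pos (q.a_pos 1) 2) (norm_pos_iff.2 (sub_ne_zero.2 hne))
  -- Dividing the constant Wronskian by `a_{n+1}` bounds a multiple of `1 / a_{n+1}` by products of
  -- two square-summable solutions.
  refine h.not_summable_inv hN ?_
  rw [← summable_mul_left_iff hW.ne']
  refine (((hs.add hs').add hs1).add hs1').of_nonneg_of_le
    (fun n => mul_nonneg hW.le (inv_nonneg.2 (q.a_pos _).le)) fun n => ?_
  have hw := congrArg norm (q.wronskian_weylSol z m m' n)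
  rw [norm_mul, norm_mul, norm_pow, Complex.norm_real, Complex.norm_real, Real.norm_eq_abs,
    Real.norm_eq_abs, abs_of_pos (q.a_pos _), abs_of_pos (q.a_pos _)] at hw
  rw [← hw, mul_comm, inv_mul_cancel_left₀ (q.a_pos _).ne']
  refine (norm_sub_le _ _).trans ?_
  rw [norm_mul, norm_mul]
  nlinarith [two_mul_le_add_sq ‖q.weylSol z m n‖ ‖q.weylSol z m' (n + 1)‖,
    two_mul_le_add_sq ‖q.weylSol z m (n + 1)‖ ‖q.weylSol z m' n‖, sq_nonneg ‖q.weylSol z m n‖,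
    sq_nonneg ‖q.weylSol z m' n‖, sq_nonneg ‖q.weylSol z m (n + 1)‖,
    sq_nonneg ‖q.weylSol z m' (n + 1)‖]

/-! ### Truncated matrices and their powers -/

/-- The entries of the half-line Jacobi matrix, with the site `n ≥ 1` at position `n - 1`. -/
def entry (q : JacobiCoeff) (i j : ℕ) : ℝ :=
  (if j = i then q.b (i + 1) else 0) + (if j = i + 1 then q.a (i + 2) else 0)
    + (if i = j + 1 then q.a (i + 1) else 0)

lemma entry_comm (q : JacobiCoeff) (i j : ℕ) : q.entry i j = q.entry j i := by
  have key : ∀ i j : ℕ, i < j → q.entry i j = q.entry j i := fun i j h => by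
    unfold entry
    rw [if_neg (by omega), if_neg (by omega : i ≠ j + 1), if_neg (by omega : i ≠ j)]
    by_cases h2 : j = i + 1
    · subst h2
      rw [if_pos rfl, if_neg (by omega : ¬ i = i + 1 + 1), if_pos rfl]
      push_cast
      ring_nf
    · rw [if_neg h2, if_neg h2, if_neg (by omega)]
  rcases lt_trichotomy i j with h | rfl | h
  · exact key i j h
  · rfl
  · exact (key j i h).symm

/-- The truncation of the half-line Jacobi matrix to the sites `1, …, L + 1`. -/
def truncation (q : JacobiCoeff) (L : ℕ) : Matrix (Fin (L + 1)) (Fin (L + 1)) ℝ :=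
  .of fun i j => q.entry i j

lemma truncation_isHermitian (q : JacobiCoeff) (L : ℕ) : (q.truncation L).IsHermitian := by
  ext i j
  simp [truncation, q.entry_comm j i]

lemma abs_entry_le {q : JacobiCoeff} {M : ℝ} {i j : ℕ}
    (ha : ∀ n : ℕ, n ≤ j + 2 → q.a n ≤ M) (hb : ∀ n : ℕ, n ≤ j + 2 → |q.b n| ≤ M) :
    |q.entry i j| ≤ M * ((if j = i then 1 else 0) + (if j = i + 1 then 1 else 0)
      + (if i = j + 1 then 1 else 0)) := by
  unfold entry
  refine (abs_add_three _ _ _).trans ?_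
  rw [mul_add, mul_add]
  refine add_le_add (add_le_add ?_ ?_) ?_
  · split_ifs with h
    · subst h; simpa using hb (j + 1) (by omega)
    · simp
  · split_ifs with h
    · subst h; rw [abs_of_pos (q.a_pos _)]; simpa using ha (i + 2) (by omega)
    · simp
  · split_ifs with h
    · subst h; rw [abs_of_pos (q.a_pos _)]; simpa [add_assoc] using ha (j + 2) (by omega)
    · simp

lemma sum_neighbours_le (L i : ℕ) : ∑ j : Fin (L + 1), ((if (j : ℕ) = i then (1 : ℝ) else 0)
    + (if (j : ℕ) = i + 1 then 1 else 0) + (if i = (j : ℕ) + 1 then 1 else 0)) ≤ 3 := by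
  have one (P : Fin (L + 1) → Prop) [DecidablePred P] (hP : ∀ x y, P x → P y → x = y) :
      ∑ j : Fin (L + 1), (if P j then (1 : ℝ) else 0) ≤ 1 := by
    rw [Finset.sum_boole]
    exact_mod_cast Finset.card_le_one.2 fun x hx y hy => hP x y (by simpa using hx) (by simpa using hy)
  rw [Finset.sum_add_distrib, Finset.sum_add_distrib]
  have h1 := one (fun j => (j : ℕ) = i) fun x y hx hy => Fin.ext (by omega)
  have h2 := one (fun j => (j : ℕ) = i + 1) fun x y hx hy => Fin.ext (by omega)
  have h3 := one (fun j => i = (j : ℕ) + 1) fun x y hx hy => Fin.ext (by omega)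
  linarith

/-- A row has at most three nonzero entries, and `p` nearest-neighbour steps from position `0` stay
within positions `≤ p`. Carrying this vanishing through the induction keeps the bound independent of
`L`. -/
lemma abs_truncation_pow_le {q : JacobiCoeff} {M : ℝ} (hM : 0 ≤ M) {P : ℕ}
    (ha : ∀ n : ℕ, n ≤ P + 1 → q.a n ≤ M) (hb : ∀ n : ℕ, n ≤ P + 1 → |q.b n| ≤ M) (L p : ℕ)
    (hp : p ≤ P) (i : Fin (L + 1)) :
    |(q.truncation L ^ p) i 0| ≤ (3 * M) ^ p ∧ (p < i → (q.truncation L ^ p) i 0 = 0) := by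
  induction p generalizing i with
  | zero =>
    rw [pow_zero, Matrix.one_apply]
    refine ⟨by split_ifs <;> simp, fun h => if_neg ?_⟩
    rintro rfl
    simp at h
  | succ p ih =>
    have ih := ih (by omega)
    rw [pow_succ', Matrix.mul_apply]
    constructor
    · calc |∑ j, q.truncation L i j * (q.truncation L ^ p) j 0|
          ≤ ∑ j, |q.truncation L i j * (q.truncation L ^ p) j 0| := Finset.abs_sum_le_sum_abs _ _
        _ ≤ ∑ j : Fin (L + 1), M * ((if (j : ℕ) = i then (1 : ℝ) else 0)
            + (if (j : ℕ) = i + 1 then 1 else 0) + (if (i : ℕ) = (j : ℕ) + 1 then 1 else 0))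
            * (3 * M) ^ p := by
          refine Finset.sum_le_sum fun j _ => ?_
          rw [abs_mul]
          by_cases hj : p < j
          · rw [(ih j).2 hj, abs_zero, mul_zero]
            positivity
          · exact mul_le_mul (abs_entry_le (fun n hn => ha n (by omega))
              fun n hn => hb n (by omega)) (ih j).1 (abs_nonneg _) (by positivity)
        _ ≤ (3 * M) ^ (p + 1) := by
          rw [← Finset.sum_mul, ← Finset.mul_sum, pow_succ', mul_comm 3 M]
          gcongr
          exact sum_neighbours_le L i
    · intro hi
      refine Finset.sum_eq_zero fun j _ => ?_
      by_cases hj : p < j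
      · rw [(ih j).2 hj, mul_zero]
      · rw [show q.truncation L i j = 0 from ?_, zero_mul]
        simp only [truncation, entry, Matrix.of_apply]
        rw [if_neg (by omega), if_neg (by omega), if_neg (by omega)]
        simp

/-! ### Spectral measures of the truncations -/

/-- The orthogonal matrix that diagonalizes the truncation. -/
noncomputable def eigenMatrix (q : JacobiCoeff) (L : ℕ) : Matrix (Fin (L + 1)) (Fin (L + 1)) ℝ :=
  (q.truncation_isHermitian L).eigenvectorUnitary

/-- The eigenvalues of the truncation. -/
noncomputable def eigenvalue (q : JacobiCoeff) (L : ℕ) : Fin (L + 1) → ℝ :=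
  (q.truncation_isHermitian L).eigenvalues

lemma sum_eigenMatrix_rows (q : JacobiCoeff) (L : ℕ) (k l : Fin (L + 1)) :
    ∑ i, q.eigenMatrix L k i * q.eigenMatrix L l i = if k = l then 1 else 0 := by
  have h := Unitary.coe_mul_star_self (q.truncation_isHermitian L).eigenvectorUnitary
  have h2 := congrFun (congrFun h k) l
  rwa [Matrix.mul_apply, Matrix.one_apply] at h2

lemma sum_eigenMatrix_columns (q : JacobiCoeff) (L : ℕ) (i j : Fin (L + 1)) :
    ∑ k, q.eigenMatrix L k i * q.eigenMatrix L k j = if i = j then 1 else 0 := by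
  have h := Unitary.coe_star_mul_self (q.truncation_isHermitian L).eigenvectorUnitary
  have h2 := congrFun (congrFun h i) j
  rwa [Matrix.mul_apply, Matrix.one_apply] at h2

lemma truncation_pow_zero_zero (q : JacobiCoeff) (L p : ℕ) :
    (q.truncation L ^ p) 0 0 = ∑ i, q.eigenMatrix L 0 i ^ 2 * q.eigenvalue L i ^ p := by
  conv_lhs => rw [(q.truncation_isHermitian L).spectral_theorem]
  rw [← map_pow, Matrix.diagonal_pow, Unitary.conjStarAlgAut_apply, Matrix.mul_apply]
  refine Finset.sum_congr rfl fun i _ => ?_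
  rw [Matrix.mul_diagonal, Matrix.star_apply]
  simp [eigenMatrix, eigenvalue]
  ring

lemma truncation_mul_eigenMatrix (q : JacobiCoeff) (L : ℕ) (k i : Fin (L + 1)) :
    ∑ j, q.truncation L k j * q.eigenMatrix L j i = q.eigenvalue L i * q.eigenMatrix L k i := by
  have h := congrFun ((q.truncation_isHermitian L).mulVec_eigenvectorBasis i) k
  exact h

/-- Parseval's identity in the eigenbasis. -/
lemma sum_sq_eigenMatrix_mul (q : JacobiCoeff) (L : ℕ) (g : Fin (L + 1) → ℝ) :
    ∑ k, (∑ i, q.eigenMatrix L k i * g i) ^ 2 = ∑ i, g i ^ 2 := by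
  calc ∑ k, (∑ i, q.eigenMatrix L k i * g i) ^ 2
      = ∑ k, ∑ i, ∑ j, (q.eigenMatrix L k i * q.eigenMatrix L k j) * (g i * g j) := by
        refine Finset.sum_congr rfl fun k _ => ?_
        rw [sq, Finset.sum_mul_sum]
        exact Finset.sum_congr rfl fun i _ => Finset.sum_congr rfl fun j _ => by ring
    _ = ∑ i, ∑ j, (∑ k, q.eigenMatrix L k i * q.eigenMatrix L k j) * (g i * g j) := by
        rw [Finset.sum_comm]
        refine Finset.sum_congr rfl fun i _ => ?_
        rw [Finset.sum_comm]
        exact Finset.sum_congr rfl fun j _ => (Finset.sum_mul _ _ _).symm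
    _ = ∑ i, g i ^ 2 := by
        simp [sum_eigenMatrix_columns, sq]

/-- The spectral measure of the truncation at the first site. -/
noncomputable def truncMeasure (q : JacobiCoeff) (L : ℕ) : Measure ℝ :=
  ∑ i, ENNReal.ofReal (q.eigenMatrix L 0 i ^ 2) • Measure.dirac (q.eigenvalue L i)

instance (q : JacobiCoeff) (L : ℕ) : IsProbabilityMeasure (q.truncMeasure L) := by
  constructor
  have h := q.sum_eigenMatrix_rows L 0 0
  rw [if_pos rfl] at h
  simp only [truncMeasure, Measure.coe_finsetSum, Finset.sum_apply, Measure.smul_apply,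
    measure_univ, smul_eq_mul, mul_one]
  rw [← ENNReal.ofReal_sum_of_nonneg fun _ _ => sq_nonneg _]
  simp_rw [sq]
  rw [h, ENNReal.ofReal_one]

lemma lintegral_truncMeasure (q : JacobiCoeff) (L : ℕ) (f : ℝ → ℝ) (hf : ∀ x, 0 ≤ f x) :
    ∫⁻ x, ENNReal.ofReal (f x) ∂q.truncMeasure L
      = ENNReal.ofReal (∑ i, q.eigenMatrix L 0 i ^ 2 * f (q.eigenvalue L i)) := by
  rw [ENNReal.ofReal_sum_of_nonneg fun _ _ => mul_nonneg (sq_nonneg _) (hf _)]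
  simp only [truncMeasure, lintegral_finsetSum_measure, lintegral_smul_measure, lintegral_dirac,
    smul_eq_mul]
  exact Finset.sum_congr rfl fun i _ => (ENNReal.ofReal_mul (sq_nonneg _)).symm

lemma integral_truncMeasure (q : JacobiCoeff) (L : ℕ) (f : ℝ → ℂ) :
    ∫ x, f x ∂q.truncMeasure L
      = ∑ i, (q.eigenMatrix L 0 i : ℂ) ^ 2 * f (q.eigenvalue L i) := by
  rw [truncMeasure, integral_finsetSum_measure fun i _ =>
    (integrable_dirac (by simp)).smul_measure ENNReal.ofReal_ne_top]
  refine Finset.sum_congr rfl fun i _ => ?_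
  rw [integral_smul_measure, integral_dirac, ENNReal.toReal_ofReal (sq_nonneg _)]
  simp

lemma lintegral_pow_truncMeasure_le {q : JacobiCoeff} {M : ℝ} (hM : 0 ≤ M) {p : ℕ} (hp : Even p)
    (ha : ∀ n : ℕ, n ≤ p + 1 → q.a n ≤ M) (hb : ∀ n : ℕ, n ≤ p + 1 → |q.b n| ≤ M) (L : ℕ) :
    ∫⁻ x, ENNReal.ofReal (x ^ p) ∂q.truncMeasure L ≤ ENNReal.ofReal ((3 * M) ^ p) := by
  rw [lintegral_truncMeasure _ _ _ fun x => hp.pow_nonneg x, ← truncation_pow_zero_zero]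
  exact ENNReal.ofReal_le_ofReal
    ((le_abs_self _).trans (abs_truncation_pow_le hM ha hb L p le_rfl 0).1)

/-! ### Resolvents and Weyl disks -/

/-- The Stieltjes transform of the spectral measure of the truncation. -/
noncomputable def truncWeyl (q : JacobiCoeff) (L : ℕ) (z : ℂ) : ℂ :=
  ∫ x : ℝ, 1 / ((x : ℂ) - z) ∂q.truncMeasure L

/-- The column `(J - z)⁻¹ δ_0` of the resolvent of the truncation `J`. -/
noncomputable def resolventColumn (q : JacobiCoeff) (L : ℕ) (z : ℂ) (k : Fin (L + 1)) : ℂ :=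
  ∑ i, (q.eigenMatrix L k i : ℂ) * (q.eigenMatrix L 0 i * (1 / ((q.eigenvalue L i : ℂ) - z)))

lemma resolventColumn_zero (q : JacobiCoeff) (L : ℕ) (z : ℂ) :
    q.resolventColumn L z 0 = q.truncWeyl L z := by
  rw [resolventColumn, truncWeyl, integral_truncMeasure]
  exact Finset.sum_congr rfl fun i _ => by ring

lemma ofReal_sub_ne_zero {z : ℂ} (hz : 0 < z.im) (x : ℝ) : (x : ℂ) - z ≠ 0 := fun h => by
  have := congrArg Complex.im h
  simp at this
  exact hz.ne' this

lemma truncation_mul_resolventColumn (q : JacobiCoeff) (L : ℕ) {z : ℂ} (hz : 0 < z.im)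
    (k : Fin (L + 1)) :
    ∑ j, (q.truncation L k j : ℂ) * q.resolventColumn L z j
      = z * q.resolventColumn L z k + if k = 0 then 1 else 0 := by
  have h1 : ((if k = 0 then 1 else 0 : ℝ) : ℂ) = if k = 0 then 1 else 0 := by split_ifs <;> simp
  simp only [resolventColumn, Finset.mul_sum]
  rw [Finset.sum_comm, ← h1, ← sum_eigenMatrix_rows, Complex.ofReal_sum, ← Finset.sum_add_distrib]
  refine Finset.sum_congr rfl fun i _ => ?_
  have h2 := congrArg (fun x : ℝ => (x : ℂ)) (q.truncation_mul_eigenMatrix L k i)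
  push_cast at h2
  have h3 := ofReal_sub_ne_zero hz (q.eigenvalue L i)
  simp_rw [← mul_assoc, ← Finset.sum_mul]
  rw [h2]
  push_cast
  field_simp
  ring

lemma im_one_div_sub (z : ℂ) (x : ℝ) :
    (1 / ((x : ℂ) - z)).im = z.im * ‖1 / ((x : ℂ) - z)‖ ^ 2 := by
  rw [one_div, Complex.inv_im, norm_inv, inv_pow, Complex.normSq_eq_norm_sq]
  simp [div_eq_mul_inv]

/-- The eigenvectors are real, so Parseval applies to real and imaginary parts separately; then `Im
(1/(λ - z)) = Im z · |1/(λ - z)|²`. -/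
lemma sum_normSq_resolventColumn (q : JacobiCoeff) (L : ℕ) {z : ℂ} (hz : 0 < z.im) :
    ∑ k, ‖q.resolventColumn L z k‖ ^ 2 = (q.truncWeyl L z).im / z.im := by
  have hre := q.sum_sq_eigenMatrix_mul L fun i =>
    q.eigenMatrix L 0 i * (1 / ((q.eigenvalue L i : ℂ) - z)).re
  have him := q.sum_sq_eigenMatrix_mul L fun i =>
    q.eigenMatrix L 0 i * (1 / ((q.eigenvalue L i : ℂ) - z)).im
  have hnorm (w : ℂ) : ‖w‖ ^ 2 = w.re ^ 2 + w.im ^ 2 := by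
    rw [← Complex.normSq_eq_norm_sq, Complex.normSq_apply]; ring
  have hk (k) : ‖q.resolventColumn L z k‖ ^ 2
      = (∑ i, q.eigenMatrix L k i * (q.eigenMatrix L 0 i *
          (1 / ((q.eigenvalue L i : ℂ) - z)).re)) ^ 2
        + (∑ i, q.eigenMatrix L k i * (q.eigenMatrix L 0 i *
          (1 / ((q.eigenvalue L i : ℂ) - z)).im)) ^ 2 := by
    rw [hnorm, resolventColumn, Complex.re_sum, Complex.im_sum]
    simp only [Complex.re_ofReal_mul, Complex.im_ofReal_mul]
  simp_rw [hk]
  rw [Finset.sum_add_distrib, hre, him, ← Finset.sum_add_distrib, truncWeyl,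
    integral_truncMeasure, Complex.im_sum, Finset.sum_div]
  refine Finset.sum_congr rfl fun i _ => ?_
  have h := im_one_div_sub z (q.eigenvalue L i)
  rw [hnorm] at h
  rw [← Complex.ofReal_pow, Complex.im_ofReal_mul, eq_div_iff hz.ne']
  linear_combination (-q.eigenMatrix L 0 i ^ 2) * h

/-- The last row is excluded: there the truncation drops the coupling to the next site. -/
lemma sum_truncation_mul (q : JacobiCoeff) (L : ℕ) (u : ℕ → ℂ) (k : ℕ) (hk : k + 1 < L + 1) :
    ∑ j : Fin (L + 1), (q.truncation L ⟨k, by omega⟩ j : ℂ) * u j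
      = q.b (k + 1) * u k + q.a (k + 2) * u (k + 1)
        + if k = 0 then 0 else q.a (k + 1) * u (k - 1) := by
  have : ∀ j : Fin (L + 1), (q.truncation L ⟨k, by omega⟩ j : ℂ) * u j
      = (fun j : ℕ => ((q.entry k j : ℝ) : ℂ) * u j) j := fun j => rfl
  rw [Finset.sum_congr rfl fun j _ => this j, Fin.sum_univ_eq_sum_range
    (fun j : ℕ => ((q.entry k j : ℝ) : ℂ) * u j)]
  simp only [entry, Complex.ofReal_add, add_mul, Finset.sum_add_distrib, apply_ite Complex.ofReal,
    Complex.ofReal_zero, ite_mul, zero_mul, Finset.sum_ite_eq']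
  rw [if_pos (by simp; omega), if_pos (by simpa using hk)]
  congr 1
  rcases k with _ | k
  · simp
  · simp only [Nat.add_right_cancel_iff, Finset.sum_ite_eq]
    rw [if_pos (by simp; omega)]
    simp

/-- The column of the resolvent solves the Jacobi equation. -/
lemma weylSol_truncWeyl (q : JacobiCoeff) (L : ℕ) {z : ℂ} (hz : 0 < z.im) (k : ℕ) (hk : k < L + 1) :
    q.weylSol z (q.truncWeyl L z) (k + 1) = -(q.a 1 * q.resolventColumn L z ⟨k, hk⟩) := by
  set u : ℕ → ℂ := fun k => if h : k < L + 1 then q.resolventColumn L z ⟨k, h⟩ else 0 with hu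
  have hu' (j : Fin (L + 1)) : q.resolventColumn L z j = u j := by
    simp only [hu, j.2, dite_true]
  suffices h : ∀ k, k < L + 1 → q.weylSol z (q.truncWeyl L z) (k + 1) = -(q.a 1 * u k) by
    rw [h k hk, hu']
  have hrow (k : ℕ) (hk : k + 1 < L + 1) : q.b (k + 1) * u k + q.a (k + 2) * u (k + 1)
        + (if k = 0 then 0 else q.a (k + 1) * u (k - 1)) = z * u k + if k = 0 then 1 else 0 := by
    rw [← q.sum_truncation_mul L u k hk]
    have := q.truncation_mul_resolventColumn L hz ⟨k, by omega⟩
    simp only [hu'] at this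
    rw [this]
    simp [Fin.ext_iff]
  intro k
  induction k using Nat.strong_induction_on with
  | _ k ih =>
    intro hk
    rcases k with _ | k
    · rw [weylSol_one, ← resolventColumn_zero, hu']; rfl
    · rw [weylSol_add_two, div_eq_iff (q.a_ne_zero _), ih k (by omega) (by omega)]
      have h := hrow k hk
      rcases k with _ | k
      -- In row `0` the source term `δ_0` plays the role of the boundary value `f_0 = 1`.
      · rw [weylSol_zero]
        simp at h ⊢
        linear_combination (q.a 1 : ℂ) * h
      · rw [ih k (by omega) (by omega)]
        simp at h ⊢
        linear_combination (q.a 1 : ℂ) * h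

lemma sum_weylSol_truncWeyl_le (q : JacobiCoeff) {l L : ℕ} (hl : l ≤ L + 1) {z : ℂ}
    (hz : 0 < z.im) :
    ∑ n ∈ Finset.Icc 1 l, ‖q.weylSol z (q.truncWeyl L z) n‖ ^ 2
      ≤ q.a 1 ^ 2 * (q.truncWeyl L z).im / z.im := by
  calc ∑ n ∈ Finset.Icc 1 l, ‖q.weylSol z (q.truncWeyl L z) n‖ ^ 2
      ≤ ∑ n ∈ Finset.Icc 1 (L + 1), ‖q.weylSol z (q.truncWeyl L z) n‖ ^ 2 :=
        Finset.sum_le_sum_of_subset_of_nonneg (Finset.Icc_subset_Icc le_rfl hl)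
          fun _ _ _ => by positivity
    _ = ∑ k : Fin (L + 1), q.a 1 ^ 2 * ‖q.resolventColumn L z k‖ ^ 2 := by
        rw [sum_Icc_one_eq_sum_range, ← Fin.sum_univ_eq_sum_range
          (fun k => ‖q.weylSol z (q.truncWeyl L z) (k + 1)‖ ^ 2)]
        refine Finset.sum_congr rfl fun k _ => ?_
        rw [q.weylSol_truncWeyl L hz k k.2, norm_neg, norm_mul, mul_pow, Complex.norm_real,
          Real.norm_eq_abs, sq_abs]
    _ = q.a 1 ^ 2 * (q.truncWeyl L z).im / z.im := by
        rw [← Finset.mul_sum, sum_normSq_resolventColumn q L hz, mul_div_assoc]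

/-! ### Uniform exponential moments -/

lemma HasSlowGrowth.lintegral_pow_truncMeasure_le {q : JacobiCoeff} {N : ℕ} (hN : 1 ≤ N)
    (h : q.HasSlowGrowth N) {ε : ℝ} (hε : 0 < ε) :
    ∃ K : ℝ, 0 ≤ K ∧ ∀ L i : ℕ, ∫⁻ x, ENNReal.ofReal (x ^ (N * (2 * i))) ∂q.truncMeasure L
      ≤ ENNReal.ofReal ((3 ^ N * ε * (N * (2 * i : ℕ) + K)) ^ (2 * i)) := by
  obtain ⟨K, hK, hb⟩ := h ε hε
  have hN' : N ≠ 0 := by omega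
  -- The extra `1` is there because the `p`-th moment involves indices up to `p + 1`.
  refine ⟨1 + K, by positivity, fun L i => ?_⟩
  set p := N * (2 * i) with hp
  set B : ℝ := ε * (p + (1 + K)) with hB
  have hB0 : 0 ≤ B := by positivity
  set M : ℝ := B ^ ((N : ℝ)⁻¹) with hM
  have hM0 : 0 ≤ M := Real.rpow_nonneg hB0 _
  have hMN : M ^ N = B := Real.rpow_inv_natCast_pow hB0 hN'
  have hle (n : ℕ) (hn : n ≤ p + 1) : ε * (|((n : ℤ) : ℝ)| + K) ≤ M ^ N := by
    rw [hMN, hB]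
    refine mul_le_mul_of_nonneg_left ?_ hε.le
    have : (n : ℝ) ≤ p + 1 := by exact_mod_cast hn
    rw [Int.cast_natCast, Nat.abs_cast]
    linarith
  refine (JacobiCoeff.lintegral_pow_truncMeasure_le hM0 (by rw [hp]; exact (even_two_mul i).mul_left N)
    (fun n hn => ?_) (fun n hn => ?_) L).trans (le_of_eq ?_)
  · exact le_of_pow_le_pow_left₀ hN' hM0 ((hb n).1.trans (hle n hn))
  · exact le_of_pow_le_pow_left₀ hN' hM0 ((hb n).2.trans (hle n hn))
  · rw [hp, pow_mul, mul_pow, hMN, hB, hp]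
    push_cast
    ring_nf

/-- Since `exp ≤ 2 cosh`, only even powers are needed, and `y^k / k! ≤ e^y` cancels the growth of
the moments against the factorials. -/
lemma HasSlowGrowth.lintegral_exp_truncMeasure_le {q : JacobiCoeff} {N : ℕ} (hN : 1 ≤ N)
    (h : q.HasSlowGrowth N) {c : ℝ} (hc : 0 < c) :
    ∃ D : ENNReal, D < ⊤ ∧ ∀ L : ℕ,
      ∫⁻ x, ENNReal.ofReal (Real.exp (c * |x| ^ N)) ∂q.truncMeasure L ≤ D := by
  -- Chosen so that `c · 3^N · ε · e^N = 1/2`, which makes the series geometric with ratio `1/4`.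
  set ε : ℝ := (2 * c * 3 ^ N * Real.exp N)⁻¹ with hε
  have hε0 : 0 < ε := by positivity
  obtain ⟨K, hK, hm⟩ := h.lintegral_pow_truncMeasure_le hN hε0
  have hs : Summable fun i : ℕ => 2 * Real.exp K * (1 / 4 : ℝ) ^ i :=
    (summable_geometric_of_lt_one (by norm_num) (by norm_num)).mul_left _
  refine ⟨∑' i : ℕ, ENNReal.ofReal (2 * Real.exp K * (1 / 4 : ℝ) ^ i), ?_, fun L => ?_⟩
  · rw [← ENNReal.ofReal_tsum_of_nonneg (fun i => by positivity) hs]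
    exact ENNReal.ofReal_lt_top
  calc ∫⁻ x, ENNReal.ofReal (Real.exp (c * |x| ^ N)) ∂q.truncMeasure L
      ≤ ∫⁻ x, ∑' i : ℕ, ENNReal.ofReal (2 * c ^ (2 * i) / (2 * i).factorial)
          * ENNReal.ofReal (x ^ (N * (2 * i))) ∂q.truncMeasure L := by
        refine lintegral_mono fun x => ?_
        have hcosh := (Real.hasSum_cosh (c * |x| ^ N)).mul_left 2
        have hnn (i : ℕ) : 0 ≤ 2 * ((c * |x| ^ N) ^ (2 * i) / ((2 * i).factorial : ℝ)) := by
          positivity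
        calc ENNReal.ofReal (Real.exp (c * |x| ^ N))
            ≤ ENNReal.ofReal (2 * Real.cosh (c * |x| ^ N)) := by
              refine ENNReal.ofReal_le_ofReal ?_
              rw [Real.cosh_eq]
              linarith [Real.exp_pos (-(c * |x| ^ N))]
          _ = ∑' i : ℕ, ENNReal.ofReal (2 * ((c * |x| ^ N) ^ (2 * i) / (2 * i).factorial)) := by
              rw [← hcosh.tsum_eq, ENNReal.ofReal_tsum_of_nonneg hnn hcosh.summable]
          _ = _ := by
              refine tsum_congr fun i => ?_
              rw [← ENNReal.ofReal_mul (by positivity), mul_pow, ← pow_mul,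
                ((even_two_mul i).mul_left N).pow_abs]
              ring_nf
    _ = ∑' i : ℕ, ENNReal.ofReal (2 * c ^ (2 * i) / (2 * i).factorial)
          * ∫⁻ x, ENNReal.ofReal (x ^ (N * (2 * i))) ∂q.truncMeasure L := by
        rw [lintegral_tsum fun i => by fun_prop]
        exact tsum_congr fun i => lintegral_const_mul _ (by fun_prop)
    _ ≤ ∑' i : ℕ, ENNReal.ofReal (2 * Real.exp K * (1 / 4 : ℝ) ^ i) := by
        refine ENNReal.tsum_le_tsum fun i => (mul_le_mul_right (hm L i) _).trans ?_
        rw [← ENNReal.ofReal_mul (by positivity)]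
        refine ENNReal.ofReal_le_ofReal ?_
        have hf := Real.pow_div_factorial_le_exp _
          (by positivity : (0 : ℝ) ≤ N * (2 * i : ℕ) + K) (2 * i)
        have hcε : c * (3 ^ N * ε) * Real.exp N = 1 / 2 := by
          rw [hε]
          field_simp
        calc 2 * c ^ (2 * i) / (2 * i).factorial * (3 ^ N * ε * (N * (2 * i : ℕ) + K)) ^ (2 * i)
            = 2 * (c * (3 ^ N * ε)) ^ (2 * i)
              * ((N * (2 * i : ℕ) + K) ^ (2 * i) / (2 * i).factorial) := by
              rw [mul_pow (3 ^ N * ε), mul_pow c]; ring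
          _ ≤ 2 * (c * (3 ^ N * ε)) ^ (2 * i) * Real.exp (N * (2 * i : ℕ) + K) := by gcongr
          _ = 2 * Real.exp K * (c * (3 ^ N * ε) * Real.exp N) ^ (2 * i) := by
              rw [Real.exp_add, mul_comm (N : ℝ), Real.exp_nat_mul, mul_pow _ (Real.exp N)]; ring
          _ = _ := by rw [hcε, pow_mul]; norm_num

/-! ### Weak limits of the truncated measures -/

/-- The spectral measures of the truncations as probability measures. -/
noncomputable def truncProb (q : JacobiCoeff) (L : ℕ) : ProbabilityMeasure ℝ :=
  ⟨q.truncMeasure L, inferInstance⟩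

lemma HasSlowGrowth.isTightMeasureSet {q : JacobiCoeff} {N : ℕ} (hN : 1 ≤ N)
    (h : q.HasSlowGrowth N) : IsTightMeasureSet (Set.range q.truncMeasure) := by
  obtain ⟨D, hD, hle⟩ := h.lintegral_exp_truncMeasure_le hN one_pos
  refine isTightMeasureSet_of_tendsto_measure_norm_gt ?_
  have hlim : Tendsto (fun r : ℝ => D / ENNReal.ofReal r) atTop (nhds 0) := by
    have := ENNReal.Tendsto.const_div (a := D) ENNReal.tendsto_ofReal_atTop (Or.inr hD.ne)
    simpa using this
  refine tendsto_of_tendsto_of_tendsto_of_le_of_le' tendsto_const_nhds hlim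
    (Eventually.of_forall fun _ => zero_le) ?_
  filter_upwards [eventually_ge_atTop 1] with r hr
  refine iSup₂_le fun μ hμ => ?_
  obtain ⟨L, rfl⟩ := hμ
  have hr0 : ENNReal.ofReal r ≠ 0 := by simpa using (zero_lt_one.trans_le hr)
  rw [ENNReal.le_div_iff_mul_le (Or.inl hr0) (Or.inl ENNReal.ofReal_ne_top), mul_comm]
  refine le_trans ?_ (hle L)
  refine le_trans (mul_le_mul_right (measure_mono fun x (hx : r < ‖x‖) => ?_) _)
    (mul_meas_ge_le_lintegral₀ (by fun_prop) (ENNReal.ofReal r))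
  refine ENNReal.ofReal_le_ofReal ?_
  rw [Real.norm_eq_abs] at hx
  have h1 : |x| ≤ |x| ^ N := le_self_pow₀ (hr.trans hx.le) (by omega)
  have h2 := Real.add_one_le_exp (1 * |x| ^ N)
  linarith

/-- Prokhorov's theorem; an ultrafilter replaces the choice of a subsequence, and any limit point
will do. -/
lemma HasSlowGrowth.exists_tendsto_truncProb {q : JacobiCoeff} {N : ℕ} (hN : 1 ≤ N)
    (h : q.HasSlowGrowth N) : ∃ (F : Ultrafilter ℕ) (μ : ProbabilityMeasure ℝ),
      (F : Filter ℕ) ≤ atTop ∧ Tendsto q.truncProb F (nhds μ) := by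
  have hc : IsCompact (closure (Set.range q.truncProb)) := by
    refine isCompact_closure_of_isTightMeasureSet ?_
    convert! h.isTightMeasureSet hN
    ext μ
    constructor
    · rintro ⟨_, ⟨L, rfl⟩, rfl⟩
      exact ⟨L, rfl⟩
    · rintro ⟨L, rfl⟩
      exact ⟨_, ⟨L, rfl⟩, rfl⟩
  obtain ⟨μ, -, hμ⟩ := hc.ultrafilter_le_nhds ((hyperfilter ℕ).map q.truncProb)
    (by
      rw [Ultrafilter.coe_map, le_principal_iff, mem_map]
      exact univ_mem' fun n => subset_closure ⟨n, rfl⟩)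
  exact ⟨hyperfilter ℕ, μ, Nat.hyperfilter_le_atTop, hμ⟩

/-- The exponential need not be bounded, so it is cut off at height `K` before taking the weak
limit; monotone convergence removes the cutoff. -/
lemma lintegral_exp_le_of_tendsto {q : JacobiCoeff} {N : ℕ} {c : ℝ} {D : ENNReal}
    (hD : ∀ L : ℕ, ∫⁻ x, ENNReal.ofReal (Real.exp (c * |x| ^ N)) ∂q.truncMeasure L ≤ D)
    {F : Filter ℕ} [F.NeBot] {μ : ProbabilityMeasure ℝ} (hμ : Tendsto q.truncProb F (nhds μ)) :
    ∫⁻ x, ENNReal.ofReal (Real.exp (c * |x| ^ N)) ∂(μ : Measure ℝ) ≤ D := by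
  have hcont : Continuous fun x : ℝ => (Real.exp (c * |x| ^ N)).toNNReal := by fun_prop
  let f (K : ℕ) : BoundedContinuousFunction ℝ NNReal :=
    BoundedContinuousFunction.mkOfBound
      ⟨fun x => min (Real.exp (c * |x| ^ N)).toNNReal (K : NNReal), hcont.min continuous_const⟩ K
      fun x y => by
        rw [NNReal.dist_eq]
        refine abs_sub_le_of_nonneg_of_le (NNReal.coe_nonneg _) ?_ (NNReal.coe_nonneg _) ?_ <;>
        exact_mod_cast min_le_right _ _
  have hf (K : ℕ) : ∫⁻ x, f K x ∂(μ : Measure ℝ) ≤ D := by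
    refine le_of_tendsto' (ProbabilityMeasure.tendsto_iff_forall_lintegral_tendsto.1 hμ (f K))
      fun L => le_trans (lintegral_mono fun x => ?_) (hD L)
    exact ENNReal.coe_le_coe.2 (min_le_left _ _)
  refine le_of_tendsto' (lintegral_tendsto_of_tendsto_of_monotone
    (f := fun K x => (f K x : ENNReal)) (fun K => ?_) (Eventually.of_forall fun x => ?_)
    (Eventually.of_forall fun x => ?_)) hf
  · exact ((f K).continuous.measurable.coe_nnreal_ennreal).aemeasurable
  · intro K K' hKK'
    exact ENNReal.coe_le_coe.2 (min_le_min_left _ (by exact_mod_cast hKK'))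
  · obtain ⟨k, hk⟩ := exists_nat_ge (Real.exp (c * |x| ^ N)).toNNReal
    refine tendsto_const_nhds.congr' ?_
    filter_upwards [eventually_ge_atTop k] with K hK
    exact congrArg ENNReal.ofNNReal
      (min_eq_left (hk.trans (by exact_mod_cast hK) : _ ≤ (K : NNReal))).symm

lemma tendsto_truncWeyl {q : JacobiCoeff} {F : Filter ℕ} {μ : ProbabilityMeasure ℝ}
    (hμ : Tendsto q.truncProb F (nhds μ)) {z : ℂ} (hz : 0 < z.im) :
    Tendsto (fun L => q.truncWeyl L z) F
      (nhds (∫ x : ℝ, 1 / ((x : ℂ) - z) ∂(μ : Measure ℝ))) := by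
  have hcont : Continuous fun x : ℝ => 1 / ((x : ℂ) - z) :=
    continuous_const.div (by fun_prop) (ofReal_sub_ne_zero hz)
  let f : BoundedContinuousFunction ℝ ℂ :=
    BoundedContinuousFunction.ofNormedAddCommGroup (fun x : ℝ => 1 / ((x : ℂ) - z)) hcont
      (1 / z.im) fun x => by
        rw [norm_div, norm_one]
        refine one_div_le_one_div_of_le hz ?_
        have := Complex.abs_im_le_norm ((x : ℂ) - z)
        simpa [abs_of_pos hz] using this
  exact (ProbabilityMeasure.tendsto_iff_forall_integral_rclike_tendsto ℂ).1 hμ f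

lemma continuous_weylSol (q : JacobiCoeff) (z : ℂ) (n : ℕ) :
    Continuous fun m => q.weylSol z m n := by
  unfold weylSol
  fun_prop

/-- Strict positivity may be lost in a limit. If it failed, `f_1 = f_2 = 0`, and the recurrence
would force `f_0 = 0`, against `f_0 = 1`. -/
lemma im_pos_of_sum_weylSol_le {q : JacobiCoeff} {z m : ℂ} (hz : 0 < z.im)
    (h : ∑ n ∈ Finset.Icc 1 2, ‖q.weylSol z m n‖ ^ 2 ≤ q.a 1 ^ 2 * m.im / z.im) : 0 < m.im := by
  by_contra! hm
  have h1 : q.a 1 ^ 2 * m.im / z.im ≤ 0 :=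
    div_nonpos_of_nonpos_of_nonneg (mul_nonpos_of_nonneg_of_nonpos (sq_nonneg _) hm) hz.le
  have h2 : q.weylSol z m 1 = 0 ∧ q.weylSol z m 2 = 0 := by
    rw [sum_Icc_one_eq_sum_range, Finset.sum_range_succ, Finset.sum_range_one] at h
    constructor <;> rw [← norm_eq_zero, ← sq_eq_zero_iff] <;>
      nlinarith [sq_nonneg ‖q.weylSol z m (0 + 1)‖, sq_nonneg ‖q.weylSol z m (1 + 1)‖]
  have h3 := q.mul_weylSol_add_two z m 0
  rw [zero_add, zero_add, h2.1, h2.2, weylSol_zero] at h3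
  simp at h3
  exact (q.a_pos 1).ne' h3

lemma HasSlowGrowth.exists_isSpectralMeasure {q : JacobiCoeff} {N : ℕ} (hN : 1 ≤ N)
    (h : q.HasSlowGrowth N) : ∃ σ : Measure ℝ, q.IsSpectralMeasure σ ∧ ∀ c : ℝ, 0 < c →
      ∫⁻ x, ENNReal.ofReal (Real.exp (c * |x| ^ N)) ∂σ < ⊤ := by
  obtain ⟨F, μ, hF, hμ⟩ := h.exists_tendsto_truncProb hN
  refine ⟨μ, ⟨inferInstance, fun z hz => ?_⟩, fun c hc => ?_⟩
  · have hmem (l : ℕ) : ∑ n ∈ Finset.Icc 1 l,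
        ‖q.weylSol z (∫ x : ℝ, 1 / ((x : ℂ) - z) ∂(μ : Measure ℝ)) n‖ ^ 2
        ≤ q.a 1 ^ 2 * (∫ x : ℝ, 1 / ((x : ℂ) - z) ∂(μ : Measure ℝ)).im / z.im := by
      have ht := tendsto_truncWeyl hμ hz
      refine le_of_tendsto_of_tendsto
        ((Continuous.tendsto (continuous_finsetSum _ fun n _ =>
          (q.continuous_weylSol z n).norm.pow 2) _).comp ht)
        (((Complex.continuous_im.tendsto _).comp ht).const_mul _ |>.div_const _) ?_
      -- At fixed level `l` the disk inequality holds for all `L ≥ l`, and both sides are continuous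
      -- in the Weyl parameter.
      filter_upwards [hF (eventually_ge_atTop l)] with L hL
      exact q.sum_weylSol_truncWeyl_le (by omega) hz
    refine Set.eq_singleton_iff_unique_mem.2 ⟨?_, fun m' hm' => ?_⟩
    · exact Set.mem_iInter.2 fun L => ⟨im_pos_of_sum_weylSol_le hz (hmem 2), hmem (L + 1)⟩
    · exact eq_of_weylSol_bounded hN h (fun L => (Set.mem_iInter.1 hm' L).2) fun L => hmem (L + 1)
  · obtain ⟨D, hD, hle⟩ := h.lintegral_exp_truncMeasure_le hN hc
    exact (lintegral_exp_le_of_tendsto hle hμ).trans_lt hD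

end JacobiCoeff

theorem theorem2 (N : ℕ) (hN : 1 ≤ N) (q : JacobiCoeff)
    (ha : q.a =o[atBot ⊔ atTop] fun n : ℤ => |(n : ℝ)| ^ (1 / (N : ℝ)))
    (hb : q.b =o[atBot ⊔ atTop] fun n : ℤ => |(n : ℝ)| ^ (1 / (N : ℝ))) :
    q ∈ JacobiQ N := by
  have h := JacobiCoeff.hasSlowGrowth_of_isLittleO hN ha hb
  obtain ⟨σp, hσp, hp⟩ := h.exists_isSpectralMeasure hN
  obtain ⟨σm, hσm, hm⟩ := h.reflect.exists_isSpectralMeasure hN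
  exact ⟨σp, σm, hσp, hσm, fun c hc => ⟨hp c hc, hm c hc⟩⟩
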